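/- Let $k$ be a field, $R=k[X_1,\dots,X_n]$ with the standard $\mathbb Z^n$-grading, and order $\mathbb Z^n$ componentwise. For a graded module $N$ and $g\in\mathbb Z^n$ let $\Sigma^gN$ be the shift, $(\Sigma^gN)_a=N_{a-g}$; let $\operatorname{Hom}_R$ denote graded homomorphisms of degree $0$ and $\hom_R(N,N')=\bigoplus_a\operatorname{Hom}_R(\Sigma^aN,N')$. Let $E(k)$ be the graded injective hull of $k=R/(X_1,\dots,X_n)$, i.e. the module with $k$-basis $(X^{-\gamma})_{\gamma\in\mathbb N^n}$, $X^{-\gamma}$ of degree $-\gamma$, where $X^\beta\cdot X^{-\gamma}=X^{\beta-\gamma}$ if $\beta\le\gamma$ and $0$ otherwise. Let $N^\vee=\hom_R(N,E(k))$ be the Matlis dual; $R^\vee$ is identified with $E(k)$ by $f\mapsto f(1)$. For a graded module $M$ put $$F_M=\bigoplus_{g}\Sigma^gR\otimes_kM_g,\qquad E_M=\prod_{h}\operatorname{Hom}_k\big((M^\vee)_h,\Sigma^{-h}R^\vee\big)$$ (product and $\operatorname{Hom}_k$ taken in graded modules), and let $\varphi_M\colon F_M\to M\to M^{\vee\vee}\to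 E_M$ be the composite of $r\otimes m\mapsto rm$, the evaluation $m\mapsto(f'\mapsto f'(m))$, and $f''\mapsto(f'\mapsto(r\mapsto r\cdot f''(f')))$. This is the associated free-cofree presentation of $M$. For finite families $(\alpha_i)_{i\in I}$, $(\beta_j)_{j\in J}$ in $\mathbb Z^n$, a monomial matrix with cogenerator degrees $(\alpha_i)$ and generator degrees $(\beta_j)$ is a matrix $(a_{ij})\in k^{I\times J}$ with $a_{ij}=0$ unless $\beta_j\le\alpha_i$. Under Miller's correspondence, a $k$-isomorphism, it corresponds to the degree-$0$ graded homomorphism $\bigoplus_j\Sigma^{\beta_j}R\to\bigoplus_i\Sigma^{\alpha_i}R^\vee$ that sends the $j$-th canonical generator to the element whose $i$-th component is $a_{ij}X^{\beta_j-\alpha_i}$ if $\beta_j\le\alpha_i$, and $0$ otherwise. **Proposition 4.3.** Let $M$ be a finitely generated and finitely supported $\mathbb Z^n$-graded $R$-module, $d_g=\dim_kM_g$, and $I=J=\bigcup_{g\in\operatorname{supp}M}\{g\}\times\{1,\dots,d_g\}$. For every $g\in\operatorname{supp}M$ choose a basis $(e_{(g,1)},\dots,e_{(g,d_g)})$ of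 $M_g$. Let $A=(a_{(g,\mu)(h,\nu)})$ be the monomial matrix with cogenerator degrees $(g)_{(g,\mu)\in I}$ and generator degrees $(h)_{(h,\nu)\in J}$ whose entry $a_{(g,\mu)(h,\nu)}$ is the $\mu$-th coefficient of $X^{g-h}e_{(h,\nu)}\in M_g$ in the chosen basis if $h\le g$, and $0$ otherwise; that is, $X^{g-h}e_{(h,\nu)}=\sum_{\mu}a_{(g,\mu)(h,\nu)}e_{(g,\mu)}$ whenever $g\in\operatorname{supp}M$, $(h,\nu)\in J$ and $h\le g$. Then $A$ represents $\varphi_M$: the chosen bases induce isomorphisms of graded modules (of degree $0$) $$\bigoplus_{(h,\nu)\in J}\Sigma^hR\cong F_M,\qquad E_M\cong\bigoplus_{(g,\mu)\in I}\Sigma^gR^\vee,$$ the first sending the canonical generator at $(h,\nu)$ to $1\otimes e_{(h,\nu)}$, the second having as its component at $(g,\mu)$ the evaluation at the dual basis vector $e^*_{(g,\mu)}\in\operatorname{Hom}_k(M_g,k)\cong(M^\vee)_{-g}$; and under these isomorphisms $\varphi_M$ is a graded homomorphism of degree $0$ whose monomial matrix under Miller's correspondence is $A$. -/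

import Mathlib

open scoped TensorProduct DirectSum

noncomputable section

namespace FlatInj

/-! ## The standard grading of the polynomial ring -/

/-- The group of degrees `ℤⁿ`, with the componentwise order. -/
abbrev Deg (n : ℕ) : Type := Fin n → ℤ

/-- The polynomial ring `R = k[X₁, …, Xₙ]`. -/
abbrev Poly (k : Type*) [Field k] (n : ℕ) : Type _ := MvPolynomial (Fin n) k

/-- An exponent vector in `ℕⁿ`, seen as a degree in `ℤⁿ`. -/
def toDeg {n : ℕ} (γ : Fin n →₀ ℕ) : Deg n := fun i => (γ i : ℤ)

/-- The exponent vector of a degree `a ≥ 0` (negative coordinates are truncated to `0`; this is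
only used for `a ≥ 0`). -/
def toExp {n : ℕ} (a : Deg n) : Fin n →₀ ℕ := Finsupp.equivFunOnFinite.symm fun i => (a i).toNat

/-- The monomial `X ^ a` for a degree `a ≥ 0`. -/
def monom (k : Type*) [Field k] {n : ℕ} (a : Deg n) : Poly k n := MvPolynomial.monomial (toExp a) 1

/-- The standard `ℤⁿ`-grading of `k[X₁, …, Xₙ]`: the variable `Xᵢ` has the `i`-th unit vector as
its degree. -/
abbrev stdGrading (k : Type*) [Field k] (n : ℕ) : Deg n → Submodule k (Poly k n) :=
  MvPolynomial.weightedHomogeneousSubmodule k fun i => Pi.single i (1 : ℤ)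

section Exponents

variable {n : ℕ}

@[simp] theorem toDeg_zero : toDeg (0 : Fin n →₀ ℕ) = 0 := by ext; simp [toDeg]

@[simp] theorem toDeg_add (γ δ : Fin n →₀ ℕ) : toDeg (γ + δ) = toDeg γ + toDeg δ := by
  ext; simp [toDeg]

theorem toDeg_injective : Function.Injective (toDeg (n := n)) := by
  intro γ δ h
  ext i
  simpa [toDeg] using congrFun h i

theorem toDeg_nonneg (γ : Fin n →₀ ℕ) : 0 ≤ toDeg γ := fun i => by simp [toDeg]

theorem toDeg_toExp {a : Deg n} (ha : 0 ≤ a) : toDeg (toExp a) = a := by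
  ext i
  simp [toDeg, toExp, Int.toNat_of_nonneg (ha i)]

theorem weight_eq (γ : Fin n →₀ ℕ) :
    Finsupp.weight (fun i : Fin n => (Pi.single i (1 : ℤ) : Deg n)) γ = toDeg γ := by
  ext j
  simp [Finsupp.weight_apply, Finsupp.sum_fintype, toDeg, Pi.single_apply]

theorem monomial_mem {k : Type*} [Field k] (γ : Fin n →₀ ℕ) (c : k) :
    MvPolynomial.monomial γ c ∈ stdGrading k n (toDeg γ) :=
  MvPolynomial.isWeightedHomogeneous_monomial _ _ _ (weight_eq γ)

end Exponents

/-! ## Graded modules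

A `ℤⁿ`-graded `R`-module is an `R`-module `M` with a family `ℳ : ℤⁿ → Submodule k M`, the graded
pieces, such that `M = ⨁ a, ℳ a` (`DirectSum.Decomposition ℳ`) and `R_a ℳ_b ⊆ ℳ_{a + b}`
(`SetLike.GradedSMul (stdGrading k n) ℳ`). The pieces of such a module are `k`-subspaces because
`k = R₀`. -/

section Graded

variable {k : Type*} [Field k] {n : ℕ}
variable {M : Type*} [AddCommMonoid M] [Module k M]
variable {N : Type*} [AddCommMonoid N] [Module k N]

/-- The grading of the shift `Σ^g M`, with `(Σ^g M)_a = M_{a - g}`. -/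
def shift (g : Deg n) (ℳ : Deg n → Submodule k M) : Deg n → Submodule k M := fun a => ℳ (a - g)

/-- The direct sum of a family of homogeneous pieces inside an ambient module: the
`R`-submodule generated by all of the pieces. -/
def homPart [Module (Poly k n) M] (ℳ : Deg n → Submodule k M) : Submodule (Poly k n) M :=
  Submodule.span (Poly k n) (⋃ a, (ℳ a : Set M))

theorem mem_homPart [Module (Poly k n) M] {ℳ : Deg n → Submodule k M} {a : Deg n} {m : M}
    (hm : m ∈ ℳ a) : m ∈ homPart ℳ :=
  Submodule.subset_span (Set.mem_iUnion.2 ⟨a, hm⟩)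

/-- The homogeneous pieces, seen inside the module that they generate. -/
def homPartGrading [Module (Poly k n) M] [IsScalarTower k (Poly k n) M]
    (ℳ : Deg n → Submodule k M) : Deg n → Submodule k (homPart ℳ) :=
  fun a => (ℳ a).comap ((homPart ℳ).subtype.restrictScalars k)

variable [Module (Poly k n) M] [Module (Poly k n) N]

theorem map_homPart {ℳ : Deg n → Submodule k M} {𝒩 : Deg n → Submodule k N}
    (f : M →ₗ[Poly k n] N) (hf : ∀ a, ∀ m ∈ ℳ a, f m ∈ 𝒩 a) {m : M} (hm : m ∈ homPart ℳ) :
    f m ∈ homPart 𝒩 := by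
  have : homPart ℳ ≤ (homPart 𝒩).comap f := by
    refine Submodule.span_le.2 ?_
    intro x hx
    obtain ⟨a, ha⟩ := Set.mem_iUnion.1 hx
    exact mem_homPart (hf a x ha)
  exact this hm

theorem homPart_eq_top (ℳ : Deg n → Submodule k M) [DirectSum.Decomposition ℳ] (m : M) :
    m ∈ homPart ℳ := by
  induction m using DirectSum.Decomposition.inductionOn ℳ with
  | zero => exact zero_mem _
  | homogeneous m => exact mem_homPart m.2
  | add m m' h h' => exact add_mem h h'

variable [IsScalarTower k (Poly k n) M] [IsScalarTower k (Poly k n) N]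

/-- `Hom_R(M, N)`: the graded homomorphisms of degree `0`. -/
def gradedHom (ℳ : Deg n → Submodule k M) (𝒩 : Deg n → Submodule k N) :
    Submodule k (M →ₗ[Poly k n] N) where
  carrier := {φ | ∀ a, ∀ m ∈ ℳ a, φ m ∈ 𝒩 a}
  add_mem' hφ hψ a m hm := add_mem (hφ a m hm) (hψ a m hm)
  zero_mem' a _ _ := zero_mem (𝒩 a)
  smul_mem' c _ hφ a m hm := (𝒩 a).smul_mem c (hφ a m hm)

/-- The pieces `hom_R(M, N)_a = Hom_R(Σ^a M, N)`, inside the module of all `R`-linear maps. -/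
def homPieces (ℳ : Deg n → Submodule k M) (𝒩 : Deg n → Submodule k N) :
    Deg n → Submodule k (M →ₗ[Poly k n] N) :=
  fun a => gradedHom (shift a ℳ) 𝒩

/-- The graded module `hom_R(M, N) = ⨁ a, Hom_R(Σ^a M, N)`. -/
abbrev GrHom (ℳ : Deg n → Submodule k M) (𝒩 : Deg n → Submodule k N) :
    Submodule (Poly k n) (M →ₗ[Poly k n] N) :=
  homPart (homPieces ℳ 𝒩)

/-- The grading of `hom_R(M, N)`. -/
abbrev grHomGrading (ℳ : Deg n → Submodule k M) (𝒩 : Deg n → Submodule k N) :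
    Deg n → Submodule k (GrHom ℳ 𝒩) :=
  homPartGrading (homPieces ℳ 𝒩)

end Graded

/-! ## The graded injective hull of the residue field -/

/-- The graded injective hull `E(k)` of the residue field `k = R/𝔪`. It has one copy of `k` in
each degree of the negative orthant `-ℕⁿ`: the value of `x` at `γ ∈ ℕⁿ` is the coefficient of
`x` at the basis element `X ^ (-γ)`. (`injHull_gradedInjective` and `injHull_essential` below
show that it is a graded injective hull of `k`.) -/
def InjHull (k : Type*) [Field k] (n : ℕ) : Type _ := (Fin n →₀ ℕ) →₀ k

section InjHull

variable {k : Type*} [Field k] {n : ℕ}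

instance : AddCommGroup (InjHull k n) := inferInstanceAs (AddCommGroup ((Fin n →₀ ℕ) →₀ k))

instance : Module k (InjHull k n) := inferInstanceAs (Module k ((Fin n →₀ ℕ) →₀ k))

/-- The coefficient at `X ^ (-γ)`. -/
def coeffAt (γ : Fin n →₀ ℕ) : InjHull k n →ₗ[k] k :=
  Finsupp.lapply (M := k) (R := k) γ

theorem InjHull.ext {x y : InjHull k n} (h : ∀ γ, coeffAt γ x = coeffAt γ y) : x = y :=
  Finsupp.ext h

/-- The element of `E(k)` with given coefficients. -/
def InjHull.mk (c : (Fin n →₀ ℕ) → k) (hc : (Function.support c).Finite) : InjHull k n :=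
  (Finsupp.ofSupportFinite c hc : (Fin n →₀ ℕ) →₀ k)

theorem coeffAt_mk (c : (Fin n →₀ ℕ) → k) (hc : (Function.support c).Finite) (γ : Fin n →₀ ℕ) :
    coeffAt γ (InjHull.mk c hc) = c γ := rfl

/-- The basis element `X ^ (-γ)`. -/
def invMonom (k : Type*) [Field k] {n : ℕ} (γ : Fin n →₀ ℕ) : InjHull k n :=
  (Finsupp.single γ 1 : (Fin n →₀ ℕ) →₀ k)

theorem coeffAt_invMonom (γ δ : Fin n →₀ ℕ) :
    coeffAt γ (invMonom k δ) = if δ = γ then 1 else 0 := by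
  classical
  exact Finsupp.single_apply

/-- Multiplication by `X ^ β`: it sends `X ^ (-γ)` to `X ^ (β - γ)` if `β ≤ γ`, and to `0`
otherwise. -/
def contract (β : Fin n →₀ ℕ) : Module.End k (InjHull k n) :=
  (Finsupp.lcomapDomain (R := k) (M := k) (fun γ : Fin n →₀ ℕ => γ + β) (add_left_injective β) :
    ((Fin n →₀ ℕ) →₀ k) →ₗ[k] ((Fin n →₀ ℕ) →₀ k))

theorem coeffAt_contract (β γ : Fin n →₀ ℕ) (x : InjHull k n) :
    coeffAt γ (contract β x) = coeffAt (γ + β) x := rfl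

/-- The action of the polynomial ring, `k`-linear in the polynomial. -/
def action (k : Type*) [Field k] (n : ℕ) : Poly k n →ₐ[k] Module.End k (InjHull k n) :=
  AddMonoidAlgebra.lift k _ (Fin n →₀ ℕ)
    { toFun := fun β => contract β.toAdd
      map_one' := by
        refine LinearMap.ext fun x => InjHull.ext fun γ => ?_
        rw [coeffAt_contract]
        simp
      map_mul' := fun β β' => by
        refine LinearMap.ext fun x => InjHull.ext fun γ => ?_
        rw [Module.End.mul_apply]
        simp only [coeffAt_contract, toAdd_mul]
        rw [add_assoc] }

instance : Module (Poly k n) (InjHull k n) :=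
  Module.compHom (InjHull k n) (action k n).toRingHom

theorem smul_def (r : Poly k n) (x : InjHull k n) : r • x = action k n r x := rfl

instance : IsScalarTower k (Poly k n) (InjHull k n) where
  smul_assoc c r x := by simp [smul_def]

@[simp] theorem coeffAt_monomial_smul (β γ : Fin n →₀ ℕ) (c : k) (x : InjHull k n) :
    coeffAt γ ((MvPolynomial.monomial β c : Poly k n) • x) = c * coeffAt (γ + β) x := by
  have : action k n (MvPolynomial.monomial β c) = c • contract β :=
    AddMonoidAlgebra.lift_single _ _ _
  rw [smul_def, this, LinearMap.smul_apply, map_smul, coeffAt_contract, smul_eq_mul]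

/-- The grading of `E(k)`: the element `X ^ (-γ)` has degree `-γ`. -/
def hullGrading (k : Type*) [Field k] (n : ℕ) : Deg n → Submodule k (InjHull k n) := fun a =>
  { carrier := {x | ∀ γ, coeffAt γ x ≠ 0 → -toDeg γ = a}
    add_mem' := by
      intro x y hx hy γ h
      by_cases h0 : coeffAt γ x = 0
      · exact hy γ fun h1 => h (by rw [map_add, h0, h1, add_zero])
      · exact hx γ h0
    zero_mem' := fun γ h => absurd (map_zero _) h
    smul_mem' := by
      intro c x hx γ h
      exact hx γ fun h0 => h (by rw [map_smul, h0, smul_zero]) }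

theorem mem_hullGrading {a : Deg n} {x : InjHull k n} :
    x ∈ hullGrading k n a ↔ ∀ γ, coeffAt γ x ≠ 0 → -toDeg γ = a := Iff.rfl

theorem invMonom_mem (γ : Fin n →₀ ℕ) : invMonom k γ ∈ hullGrading k n (-toDeg γ) := by
  intro δ h
  rw [coeffAt_invMonom] at h
  by_cases hd : γ = δ
  · rw [hd]
  · simp [hd] at h

theorem hull_mem_homPart (x : InjHull k n) : x ∈ homPart (hullGrading k n) := by
  induction x using Finsupp.induction_linear with
  | zero => exact zero_mem _
  | add x y hx hy => exact add_mem hx hy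
  | single γ c =>
    refine mem_homPart (a := -toDeg γ) ?_
    have h : (Finsupp.single γ c : (Fin n →₀ ℕ) →₀ k) = (c • invMonom k γ : InjHull k n) := by
      refine InjHull.ext fun δ => ?_
      rw [map_smul, coeffAt_invMonom]
      change (Finsupp.single γ c : (Fin n →₀ ℕ) →₀ k) δ = _
      classical
      rw [Finsupp.single_apply]
      split_ifs <;> simp
    rw [h]
    exact (hullGrading k n _).smul_mem c (invMonom_mem γ)

end InjHull

/-! ## Matlis duality -/

section Matlis

variable {k : Type*} [Field k] {n : ℕ}
variable {M : Type*} [AddCommGroup M] [Module k M]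
  [Module (Poly k n) M] [IsScalarTower k (Poly k n) M]

/-- The Matlis dual `M^∨ = hom_R(M, E(k))`. -/
abbrev Dual (ℳ : Deg n → Submodule k M) : Submodule (Poly k n) (M →ₗ[Poly k n] InjHull k n) :=
  GrHom ℳ (hullGrading k n)

/-- The grading of `M^∨`. -/
abbrev dualGrading (ℳ : Deg n → Submodule k M) : Deg n → Submodule k (Dual ℳ) :=
  grHomGrading ℳ (hullGrading k n)

theorem mem_dualGrading {ℳ : Deg n → Submodule k M} {a : Deg n} {f : Dual ℳ} :
    f ∈ dualGrading ℳ a ↔ ∀ b, ∀ m ∈ ℳ (b - a), f.1 m ∈ hullGrading k n b := Iff.rfl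

/-- The evaluation homomorphism `u_M : M → M^∨^∨`, `u_M(m)(f') = f'(m)`. -/
def evalHom (ℳ : Deg n → Submodule k M) [DirectSum.Decomposition ℳ] :
    M →ₗ[Poly k n] Dual (dualGrading ℳ) :=
  LinearMap.codRestrict (Dual (dualGrading ℳ))
    ((Dual ℳ).subtype.flip) (fun m => by
      refine map_homPart (ℳ := ℳ) ((Dual ℳ).subtype.flip) ?_ (homPart_eq_top ℳ m)
      intro a m hm b f hf
      refine hf b m ?_
      change m ∈ ℳ (b - (b - a))
      rwa [sub_sub_cancel])

@[simp] theorem evalHom_apply (ℳ : Deg n → Submodule k M) [DirectSum.Decomposition ℳ] (m : M)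
    (f : Dual ℳ) : (evalHom ℳ m).1 f = f.1 m := rfl

end Matlis

/-! ## The associated flat-injective presentation -/

section RingDual

variable (k : Type*) [Field k] (n : ℕ)

/-- `R^∨`, the Matlis dual of the ring itself. -/
abbrev RDual : Submodule (Poly k n) (Poly k n →ₗ[Poly k n] InjHull k n) := Dual (stdGrading k n)

/-- The grading of `R^∨`. -/
abbrev rDualGrading : Deg n → Submodule k (RDual k n) := dualGrading (stdGrading k n)

variable {k n}

theorem smul_mem_hull {a b : Deg n} {r : Poly k n} {x : InjHull k n}
    (hr : r ∈ stdGrading k n a) (hx : x ∈ hullGrading k n b) : r • x ∈ hullGrading k n (a + b) := by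
  rw [← MvPolynomial.support_sum_monomial_coeff r, Finset.sum_smul]
  refine sum_mem fun β hβ γ h => ?_
  have hβ' : toDeg β = a := by
    rw [← weight_eq]
    exact hr (MvPolynomial.mem_support_iff.1 hβ)
  rw [coeffAt_monomial_smul] at h
  have := hx _ (right_ne_zero_of_mul h)
  rw [toDeg_add] at this
  rw [← hβ', ← this]
  abel

/-- For `x ∈ E(k)`, the element `r ↦ r • x` of `R^∨`; it is `R`-linear in `x`. -/
def mulHom : InjHull k n →ₗ[Poly k n] RDual k n :=
  LinearMap.codRestrict (RDual k n)
    ((LinearMap.lsmul (Poly k n) (InjHull k n)).flip) (fun x => by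
      refine map_homPart (ℳ := hullGrading k n) _ ?_ (hull_mem_homPart x)
      intro a x hx b r hr
      have := smul_mem_hull hr hx
      rwa [sub_add_cancel] at this)

theorem mulHom_mem {a : Deg n} {x : InjHull k n} (hx : x ∈ hullGrading k n a) :
    mulHom x ∈ rDualGrading k n a := by
  intro b r hr
  have := smul_mem_hull hr hx
  rwa [sub_add_cancel] at this

@[simp] theorem mulHom_apply (x : InjHull k n) (r : Poly k n) : (mulHom x).1 r = r • x := rfl

end RingDual

section Associated

variable {k : Type*} [Field k] {n : ℕ}
variable {M : Type*} [AddCommGroup M] [Module k M]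
  [Module (Poly k n) M] [IsScalarTower k (Poly k n) M]

/-- The associated flat module `F_M = ⨁ g, Σ^g R ⊗_k M_g`. -/
abbrev AssocFlat (ℳ : Deg n → Submodule k M) : Type _ := ⨁ g : Deg n, (Poly k n ⊗[k] ℳ g)

/-- The grading of `F_M`: the piece of degree `a` is `⨁ g, (Σ^g R)_a ⊗_k M_g`. -/
def assocFlatGrading (ℳ : Deg n → Submodule k M) : Deg n → Submodule k (AssocFlat ℳ) := fun a =>
  ⨅ g, (LinearMap.range (LinearMap.rTensor (ℳ g) (shift g (stdGrading k n) a).subtype)).comap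
    (DirectSum.component k (Deg n) (fun g => Poly k n ⊗[k] ℳ g) g)

/-- The homomorphism `F_M → M`, induced by `r ⊗ m ↦ r m`. -/
def assocEpi (ℳ : Deg n → Submodule k M) : AssocFlat ℳ →ₗ[Poly k n] M :=
  DirectSum.toModule (Poly k n) (Deg n) M fun g => (ℳ g).subtype.liftBaseChange (Poly k n)

/-- The product over all `h` of the modules of all `k`-linear maps from `(M^∨)_h` to `R^∨`,
in which the associated injective module lives. -/
abbrev AssocAmbient (ℳ : Deg n → Submodule k M) : Type _ :=
  ∀ h : Deg n, (dualGrading ℳ h →ₗ[k] RDual k n)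

/-- The homogeneous elements of degree `a` of `∏ h, Hom_k((M^∨)_h, Σ^{-h} R^∨)`: the families of
`k`-linear maps `(M^∨)_h → (Σ^{-h} R^∨)_a`. -/
def assocInjPieces (ℳ : Deg n → Submodule k M) : Deg n → Submodule k (AssocAmbient ℳ) := fun a =>
  { carrier := {y | ∀ h f, y h f ∈ shift (-h) (rDualGrading k n) a}
    add_mem' := fun hx hy h f => add_mem (hx h f) (hy h f)
    zero_mem' := fun h _ => zero_mem (shift (-h) (rDualGrading k n) a)
    smul_mem' := fun c _ hy h f => (shift (-h) (rDualGrading k n) a).smul_mem c (hy h f) }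

/-- The associated injective module `E_M = ∏ h, Hom_k((M^∨)_h, Σ^{-h} R^∨)`, where product and
`Hom_k` are those of graded modules, i.e. the direct sum of their homogeneous pieces. -/
abbrev AssocInj (ℳ : Deg n → Submodule k M) : Submodule (Poly k n) (AssocAmbient ℳ) :=
  homPart (assocInjPieces ℳ)

/-- The grading of `E_M`. -/
abbrev assocInjGrading (ℳ : Deg n → Submodule k M) : Deg n → Submodule k (AssocInj ℳ) :=
  homPartGrading (assocInjPieces ℳ)

/-- The formula `f'' ↦ (f' ↦ (r ↦ r • f''(f')))` for all `R`-linear `f'' : M^∨ → E(k)`. -/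
def assocMonoAux (ℳ : Deg n → Submodule k M) :
    (Dual ℳ →ₗ[Poly k n] InjHull k n) →ₗ[Poly k n] AssocAmbient ℳ where
  toFun f'' := fun h =>
    (mulHom.restrictScalars k) ∘ₗ (f''.restrictScalars k) ∘ₗ (dualGrading ℳ h).subtype
  map_add' f g := by
    funext h
    ext f'
    simp
  map_smul' r f := by
    funext h
    ext f'
    simp

/-- The homomorphism `M^∨^∨ → E_M`, `f'' ↦ (f' ↦ (r ↦ r • f''(f')))`. -/
def assocMono (ℳ : Deg n → Submodule k M) : Dual (dualGrading ℳ) →ₗ[Poly k n] AssocInj ℳ :=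
  LinearMap.codRestrict (AssocInj ℳ) (assocMonoAux ℳ ∘ₗ (Dual (dualGrading ℳ)).subtype)
    (fun f'' => by
      refine map_homPart (assocMonoAux ℳ) ?_ f''.2
      intro a f hf h f'
      change mulHom (f f'.1) ∈ rDualGrading k n (a - -h)
      refine mulHom_mem (hf _ f'.1 ?_)
      change f'.1 ∈ dualGrading ℳ (a - -h - a)
      have : a - -h - a = h := by abel
      rw [this]
      exact f'.2)

@[simp] theorem assocMono_apply (ℳ : Deg n → Submodule k M) (f'' : Dual (dualGrading ℳ))
    (h : Deg n) (f' : dualGrading ℳ h) (r : Poly k n) :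
    ((assocMono ℳ f'').1 h f').1 r = r • f''.1 f'.1 := rfl

/-- The associated flat-injective presentation `φ_M : F_M → M → M^∨^∨ → E_M` of `M`. -/
def assocPres (ℳ : Deg n → Submodule k M) [DirectSum.Decomposition ℳ] :
    AssocFlat ℳ →ₗ[Poly k n] AssocInj ℳ :=
  assocMono ℳ ∘ₗ evalHom ℳ ∘ₗ assocEpi ℳ

end Associated

/-! ## Homogeneous elements of the Matlis dual from functionals on a graded piece -/

section DualElement

variable {k : Type*} [Field k] {n : ℕ}
variable {M : Type*} [AddCommGroup M] [Module k M]
  [Module (Poly k n) M] [IsScalarTower k (Poly k n) M]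

theorem monomial_smul_mem {ℳ : Deg n → Submodule k M}
    [SetLike.GradedSMul (stdGrading k n) ℳ] {a : Deg n} {m : M} (hm : m ∈ ℳ a)
    (γ : Fin n →₀ ℕ) (c : k) :
    (MvPolynomial.monomial γ c : Poly k n) • m ∈ ℳ (toDeg γ + a) :=
  SetLike.GradedSMul.smul_mem (monomial_mem γ c) hm

theorem monom_smul_mem {ℳ : Deg n → Submodule k M}
    [SetLike.GradedSMul (stdGrading k n) ℳ] {g h : Deg n} {m : M} (hm : m ∈ ℳ h) (hgh : h ≤ g) :
    monom k (g - h) • m ∈ ℳ g := by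
  have := monomial_smul_mem hm (toExp (g - h)) (1 : k)
  rwa [toDeg_toExp (sub_nonneg.2 hgh), sub_add_cancel] at this

theorem finite_support (ℳ : Deg n → Submodule k M) [DirectSum.Decomposition ℳ]
    [SetLike.GradedSMul (stdGrading k n) ℳ] (g : Deg n) (l : Module.Dual k (ℳ g)) (m : M) :
    (Function.support fun γ : Fin n →₀ ℕ =>
      l (DirectSum.decompose ℳ ((MvPolynomial.monomial γ (1 : k) : Poly k n) • m) g)).Finite := by
  induction m using DirectSum.Decomposition.inductionOn ℳ with
  | zero => simp [Function.support]
  | @homogeneous b m =>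
    refine Set.Finite.subset (Set.Subsingleton.finite (s := {γ | toDeg γ + b = g}) ?_) ?_
    · intro γ hγ δ hδ
      refine toDeg_injective (add_right_cancel (b := b) ?_)
      rw [Set.mem_ofPred_eq] at hγ hδ
      rw [hγ, hδ]
    · intro γ hγ
      by_contra hne
      refine hγ ?_
      have h0 := DirectSum.decompose_of_mem_ne ℳ (monomial_smul_mem m.2 γ (1 : k)) hne
      have h1 : DirectSum.decompose ℳ ((MvPolynomial.monomial γ (1 : k) : Poly k n) • (m : M)) g
          = 0 := Subtype.ext h0
      simp [h1]
  | add m m' h h' =>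
    refine Set.Finite.subset (h.union h') ?_
    intro γ hγ
    by_contra hne
    rw [Set.mem_union, not_or, Function.notMem_support, Function.notMem_support] at hne
    refine hγ ?_
    simp only [smul_add, DirectSum.decompose_add, DirectSum.add_apply, map_add, hne.1, hne.2,
      add_zero]

/-- The `R`-linear map `M → E(k)` that corresponds to a `k`-linear functional `l` on `M_g`: it
sends `m` to the element whose coefficient at `X ^ (-γ)` is the value of `l` at the component of
`X ^ γ • m` in degree `g`. -/
def dualElt (ℳ : Deg n → Submodule k M) [DirectSum.Decomposition ℳ]
    [SetLike.GradedSMul (stdGrading k n) ℳ] (g : Deg n) (l : Module.Dual k (ℳ g)) :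
    M →ₗ[Poly k n] InjHull k n where
  toFun m := InjHull.mk (fun γ : Fin n →₀ ℕ =>
      l (DirectSum.decompose ℳ ((MvPolynomial.monomial γ (1 : k) : Poly k n) • m) g))
      (finite_support ℳ g l m)
  map_add' m m' := by
    refine InjHull.ext fun γ => ?_
    simp only [map_add, coeffAt_mk, smul_add, DirectSum.decompose_add, DirectSum.add_apply]
  map_smul' r m := by
    simp only [RingHom.id_apply]
    induction r using MvPolynomial.induction_on' with
    | monomial β c =>
      refine InjHull.ext fun γ => ?_
      rw [coeffAt_monomial_smul, coeffAt_mk, coeffAt_mk, smul_smul, MvPolynomial.monomial_mul,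
        one_mul]
      have h : (MvPolynomial.monomial (γ + β) c : Poly k n) • m
          = c • ((MvPolynomial.monomial (γ + β) (1 : k) : Poly k n) • m) := by
        rw [← smul_assoc, MvPolynomial.smul_monomial, smul_eq_mul, mul_one]
      rw [h, DirectSum.decompose_smul, DirectSum.smul_apply, map_smul, smul_eq_mul]
    | add p q hp hq =>
      rw [add_smul (x := InjHull.mk _ _), ← hp, ← hq]
      refine InjHull.ext fun γ => ?_
      simp only [map_add, coeffAt_mk, add_smul, smul_add, DirectSum.decompose_add,
        DirectSum.add_apply]

theorem coeffAt_dualElt (ℳ : Deg n → Submodule k M) [DirectSum.Decomposition ℳ]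
    [SetLike.GradedSMul (stdGrading k n) ℳ] (g : Deg n) (l : Module.Dual k (ℳ g)) (m : M)
    (γ : Fin n →₀ ℕ) : coeffAt γ (dualElt ℳ g l m) =
      l (DirectSum.decompose ℳ ((MvPolynomial.monomial γ (1 : k) : Poly k n) • m) g) := rfl

theorem dualElt_mem (ℳ : Deg n → Submodule k M) [DirectSum.Decomposition ℳ]
    [SetLike.GradedSMul (stdGrading k n) ℳ] (g : Deg n) (l : Module.Dual k (ℳ g)) :
    dualElt ℳ g l ∈ homPieces ℳ (hullGrading k n) (-g) := by
  intro b m hm γ hγ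
  replace hm : m ∈ ℳ (b - -g) := hm
  by_contra hne
  refine hγ ?_
  rw [coeffAt_dualElt]
  have hne' : toDeg γ + (b - -g) ≠ g := by
    intro h
    refine hne ?_
    have h2 : toDeg γ + b = 0 := by
      have : toDeg γ + (b - -g) = (toDeg γ + b) + g := by abel
      rw [this] at h
      exact add_eq_right.1 h
    exact neg_eq_of_add_eq_zero_right h2
  have h0 := DirectSum.decompose_of_mem_ne ℳ (monomial_smul_mem hm γ (1 : k)) hne'
  have h1 : DirectSum.decompose ℳ ((MvPolynomial.monomial γ (1 : k) : Poly k n) • m) g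
      = 0 := Subtype.ext h0
  simp [h1]

/-- The element of `(M^∨)_{-g}` that corresponds to a `k`-linear functional on `M_g`, under
`(M^∨)_{-g} ≅ Hom_k(M_g, k)`. -/
def dualPiece (ℳ : Deg n → Submodule k M) [DirectSum.Decomposition ℳ]
    [SetLike.GradedSMul (stdGrading k n) ℳ] (g : Deg n) (l : Module.Dual k (ℳ g)) :
    dualGrading ℳ (-g) :=
  ⟨⟨dualElt ℳ g l, mem_homPart (dualElt_mem ℳ g l)⟩, dualElt_mem ℳ g l⟩

end DualElement

/-! `E(k)` is a graded injective hull of the residue field: it is graded injective, `X ^ 0` spans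
a copy of `k = R/𝔪` in it, and this copy is an essential submodule. -/

section HullProperties

variable {k : Type*} [Field k] {n : ℕ}

theorem injHull_gradedInjective
    {A : Type*} [AddCommGroup A] [Module k A] [Module (Poly k n) A] [IsScalarTower k (Poly k n) A]
    {B : Type*} [AddCommGroup B] [Module k B] [Module (Poly k n) B] [IsScalarTower k (Poly k n) B]
    (𝒜 : Deg n → Submodule k A) [DirectSum.Decomposition 𝒜]
    [SetLike.GradedSMul (stdGrading k n) 𝒜]
    (ℬ : Deg n → Submodule k B) [DirectSum.Decomposition ℬ]
    [SetLike.GradedSMul (stdGrading k n) ℬ]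
    (i : A →ₗ[Poly k n] B) (hi : i ∈ gradedHom 𝒜 ℬ) (hinj : Function.Injective i)
    (f : A →ₗ[Poly k n] InjHull k n) (hf : f ∈ gradedHom 𝒜 (hullGrading k n)) :
    ∃ g ∈ gradedHom ℬ (hullGrading k n), g ∘ₗ i = f := by
  let i₀ : 𝒜 0 →ₗ[k] ℬ 0 := (i.restrictScalars k).restrict (hi 0)
  have hi₀ : LinearMap.ker i₀ = ⊥ := by
    refine LinearMap.ker_eq_bot.2 fun x y hxy => Subtype.ext (hinj ?_)
    exact congrArg Subtype.val hxy
  obtain ⟨p, hp⟩ := i₀.exists_leftInverse_of_injective hi₀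
  let l : Module.Dual k (ℬ 0) :=
    (coeffAt (k := k) (0 : Fin n →₀ ℕ)) ∘ₗ (f.restrictScalars k) ∘ₗ (𝒜 0).subtype ∘ₗ p
  refine ⟨dualElt ℬ 0 l, ?_, ?_⟩
  · intro a m hm
    have h := dualElt_mem ℬ 0 l a m
    refine h ?_
    change m ∈ ℬ (a - -0)
    simpa using hm
  · ext m
    have key : ∀ m : A, f m = dualElt ℬ 0 l (i m) := by
      intro m
      induction m using DirectSum.Decomposition.inductionOn 𝒜 with
      | zero => simp
      | add m m' h h' => simp only [map_add, h, h']
      | @homogeneous b m =>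
        refine InjHull.ext fun γ => ?_
        rw [coeffAt_dualElt, ← map_smul]
        have hm := monomial_smul_mem m.2 γ (1 : k)
        have hfm : coeffAt γ (f m) =
            coeffAt 0 (f ((MvPolynomial.monomial γ (1 : k) : Poly k n) • (m : A))) := by
          rw [map_smul, coeffAt_monomial_smul, zero_add, one_mul]
        rw [hfm]
        generalize (MvPolynomial.monomial γ (1 : k) : Poly k n) • (m : A) = m' at hm
        by_cases hb : toDeg γ + b = 0
        · rw [hb] at hm
          have h1 : DirectSum.decompose ℬ (i m') 0 = i₀ ⟨m', hm⟩ :=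
            Subtype.ext (DirectSum.decompose_of_mem_same ℬ (hi 0 m' hm))
          rw [h1]
          have h2 : p (i₀ ⟨m', hm⟩) = ⟨m', hm⟩ := LinearMap.congr_fun hp _
          change _ = coeffAt 0 (f (p (i₀ ⟨m', hm⟩)).1)
          rw [h2]
        · have h1 : DirectSum.decompose ℬ (i m') 0 = 0 :=
            Subtype.ext (DirectSum.decompose_of_mem_ne ℬ (hi _ m' hm) hb)
          rw [h1, map_zero]
          by_contra h3
          have := hf _ m' hm 0 h3
          simp only [toDeg_zero, neg_zero] at this
          exact hb this.symm
    exact (key m).symm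

theorem X_smul_invMonom_zero (i : Fin n) :
    (MvPolynomial.X i : Poly k n) • invMonom k (0 : Fin n →₀ ℕ) = 0 := by
  refine InjHull.ext fun γ => ?_
  rw [MvPolynomial.X, coeffAt_monomial_smul, coeffAt_invMonom, if_neg, mul_zero, map_zero]
  intro h
  have := congrArg (fun δ : Fin n →₀ ℕ => δ i) h
  simp at this

theorem injHull_essential (x : InjHull k n) (hx : x ≠ 0) :
    ∃ r : Poly k n, r • x = invMonom k 0 := by
  have hne : (Finsupp.support (α := Fin n →₀ ℕ) (M := k) x).Nonempty :=
    Finsupp.support_nonempty_iff.2 hx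
  obtain ⟨γ, hγ, hmax⟩ := Finset.exists_max_image _ (fun γ : Fin n →₀ ℕ => γ.degree) hne
  have hγ' : coeffAt γ x ≠ 0 := Finsupp.mem_support_iff.1 hγ
  refine ⟨MvPolynomial.monomial γ (coeffAt γ x)⁻¹, InjHull.ext fun δ => ?_⟩
  rw [coeffAt_monomial_smul, coeffAt_invMonom]
  split_ifs with h
  · rw [← h, zero_add, inv_mul_cancel₀ hγ']
  · have h0 : coeffAt (δ + γ) x = 0 := by
      by_contra h1
      have := hmax (δ + γ) (Finsupp.mem_support_iff.2 h1)
      simp only [map_add] at this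
      have h2 : δ.degree = 0 := by omega
      exact h ((Finsupp.degree_eq_zero_iff δ).1 h2).symm
    rw [h0, mul_zero]

end HullProperties

/-! ## Monomial matrices -/

section MonomialMatrices

variable (k : Type*) [Field k] {n : ℕ} {ι κ : Type*}

/-- The monomial matrices with cogenerator degrees `α` (rows) and generator degrees `β`
(columns), with entrywise addition and scalar multiplication. -/
def monomialMatrix (α : ι → Deg n) (β : κ → Deg n) : Submodule k (Matrix ι κ k) where
  carrier := {A | ∀ i j, ¬ β j ≤ α i → A i j = 0}
  add_mem' := by
    intro A B hA hB i j h
    rw [Matrix.add_apply, hA i j h, hB i j h, add_zero]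
  zero_mem' _ _ _ := rfl
  smul_mem' := by
    intro c A hA i j h
    rw [Matrix.smul_apply, hA i j h, smul_zero]

/-- The grading of the free module `⨁ j, Σ^{β_j} R`. -/
def freeGrading (β : κ → Deg n) : Deg n → Submodule k (κ →₀ Poly k n) := fun a =>
  ⨅ j, (shift (β j) (stdGrading k n) a).comap (Finsupp.lapply j)

/-- The grading of the cofree module `⨁ i, Σ^{α_i} R^∨` (for a finite index set). -/
def cofreeGrading (α : ι → Deg n) : Deg n → Submodule k (ι → RDual k n) := fun a =>
  ⨅ i, (shift (α i) (rDualGrading k n) a).comap (LinearMap.proj i)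

variable {k}

theorem mem_freeGrading {β : κ → Deg n} {a : Deg n} {x : κ →₀ Poly k n} :
    x ∈ freeGrading k β a ↔ ∀ j, x j ∈ stdGrading k n (a - β j) := by
  simp [freeGrading, shift]

theorem mem_cofreeGrading {α : ι → Deg n} {a : Deg n} {y : ι → RDual k n} :
    y ∈ cofreeGrading k α a ↔ ∀ i, y i ∈ rDualGrading k n (a - α i) := by
  simp [cofreeGrading, shift]

/-- The matrix of a homomorphism `φ : ⨁ j, Σ^{β_j} R → ⨁ i, Σ^{α_i} R^∨` of degree `0`. If
`β_j ≤ α_i`, then its entry at `(i, j)` is the scalar `a` such that the `i`-th component of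
`φ(e_j)`, which has degree `β_j`, is `a` times the canonical generator `X ^ (β_j - α_i)` of
`(Σ^{α_i} R^∨)_{β_j} ≅ k`; here `f ∈ R^∨` is identified with `f(1) ∈ E(k)`. -/
def homToMatrix (α : ι → Deg n) (β : κ → Deg n)
    (φ : (κ →₀ Poly k n) →ₗ[Poly k n] (ι → RDual k n)) : Matrix ι κ k :=
  open Classical in
  Matrix.of fun i j => if β j ≤ α i then
    coeffAt (toExp (α i - β j)) ((φ (Finsupp.single j 1) i).1 1) else 0

/-- The homomorphism of a monomial matrix: the `i`-th component of the image of `e_j` is the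
scalar `A i j` times `X ^ (β_j - α_i)`. -/
def matrixToHom (α : ι → Deg n) (β : κ → Deg n) (A : Matrix ι κ k) :
    (κ →₀ Poly k n) →ₗ[Poly k n] (ι → RDual k n) :=
  Finsupp.linearCombination (Poly k n)
    fun j i => A i j • mulHom (invMonom k (toExp (α i - β j)))

theorem matrixToHom_single (α : ι → Deg n) (β : κ → Deg n) (A : Matrix ι κ k) (j : κ) (i : ι) :
    matrixToHom α β A (Finsupp.single j 1) i =
      A i j • mulHom (invMonom k (toExp (α i - β j))) := by
  simp [matrixToHom]

theorem smul_mem_rDual {a b : Deg n} {r : Poly k n} {f : RDual k n}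
    (hr : r ∈ stdGrading k n a) (hf : f ∈ rDualGrading k n b) :
    r • f ∈ rDualGrading k n (a + b) := by
  intro c s hs
  change r • f.1 s ∈ hullGrading k n c
  have h : f.1 s ∈ hullGrading k n (c - a) := by
    refine hf _ s ?_
    change s ∈ stdGrading k n (c - a - b)
    rw [sub_sub]
    exact hs
  have := smul_mem_hull hr h
  rwa [add_sub_cancel] at this

theorem single_mem_freeGrading (β : κ → Deg n) (j : κ) :
    (Finsupp.single j 1 : κ →₀ Poly k n) ∈ freeGrading k β (β j) := by
  classical
  rw [mem_freeGrading]
  intro j'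
  rw [Finsupp.single_apply]
  split_ifs with h
  · subst h
    rw [sub_self]
    exact MvPolynomial.isWeightedHomogeneous_one _ _
  · exact zero_mem _

theorem matrixToHom_mem {α : ι → Deg n} {β : κ → Deg n} {A : Matrix ι κ k}
    (hA : A ∈ monomialMatrix k α β) :
    matrixToHom α β A ∈ gradedHom (freeGrading k β) (cofreeGrading k α) := by
  intro a x hx
  rw [mem_cofreeGrading]
  intro i
  rw [mem_freeGrading] at hx
  rw [matrixToHom, Finsupp.linearCombination_apply, Finsupp.sum, Finset.sum_apply]
  refine sum_mem fun j _ => ?_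
  rw [Pi.smul_apply]
  by_cases h : β j ≤ α i
  · have h1 : mulHom (invMonom k (toExp (α i - β j))) ∈ rDualGrading k n (β j - α i) := by
      have := mulHom_mem (invMonom_mem (k := k) (toExp (α i - β j)))
      rwa [toDeg_toExp (sub_nonneg.2 h), neg_sub] at this
    have := smul_mem_rDual (hx j) ((rDualGrading k n (β j - α i)).smul_mem (A i j) h1)
    rwa [sub_add_sub_cancel] at this
  · rw [hA i j h, zero_smul, smul_zero]
    exact zero_mem _

theorem homToMatrix_mem (α : ι → Deg n) (β : κ → Deg n)
    (φ : (κ →₀ Poly k n) →ₗ[Poly k n] (ι → RDual k n)) :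
    homToMatrix α β φ ∈ monomialMatrix k α β := by
  intro i j h
  simp [homToMatrix, h]

theorem homToMatrix_matrixToHom {α : ι → Deg n} {β : κ → Deg n} {A : Matrix ι κ k}
    (hA : A ∈ monomialMatrix k α β) : homToMatrix α β (matrixToHom α β A) = A := by
  ext i j
  by_cases h : β j ≤ α i
  · simp only [homToMatrix, Matrix.of_apply, if_pos h, matrixToHom_single]
    change coeffAt _ (A i j • ((1 : Poly k n) • (invMonom k _ : InjHull k n))) = _
    rw [one_smul, map_smul, coeffAt_invMonom, if_pos rfl, smul_eq_mul, mul_one]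
  · rw [hA i j h]
    simp [homToMatrix, h]

theorem matrixToHom_homToMatrix {α : ι → Deg n} {β : κ → Deg n}
    {φ : (κ →₀ Poly k n) →ₗ[Poly k n] (ι → RDual k n)}
    (hφ : φ ∈ gradedHom (freeGrading k β) (cofreeGrading k α)) :
    matrixToHom α β (homToMatrix α β φ) = φ := by
  refine Finsupp.lhom_ext' fun j => LinearMap.ext_ring (funext fun i => ?_)
  change matrixToHom α β (homToMatrix α β φ) (Finsupp.single j 1) i = φ (Finsupp.single j 1) i
  rw [matrixToHom_single]
  have hy := mem_cofreeGrading.1 (hφ _ _ (single_mem_freeGrading β j)) i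
  have h1 : (1 : Poly k n) ∈ stdGrading k n (β j - α i - (β j - α i)) := by
    rw [sub_self]
    exact MvPolynomial.isWeightedHomogeneous_one _ _
  have hy1 := hy _ 1 h1
  refine Subtype.ext (LinearMap.ext_ring (InjHull.ext fun γ => ?_))
  change coeffAt γ (homToMatrix α β φ i j • ((1 : Poly k n) • (invMonom k _ : InjHull k n))) = _
  rw [one_smul, map_smul, coeffAt_invMonom, smul_eq_mul]
  by_cases h : β j ≤ α i
  · simp only [homToMatrix, Matrix.of_apply, if_pos h]
    split_ifs with hγ
    · rw [hγ, mul_one]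
    · rw [mul_zero]
      by_contra hne
      refine hγ (toDeg_injective ?_)
      rw [toDeg_toExp (sub_nonneg.2 h), ← neg_sub, ← hy1 γ (Ne.symm hne), neg_neg]
  · rw [homToMatrix_mem α β φ i j h, zero_mul]
    by_contra hne
    refine h (sub_nonpos.1 ?_)
    rw [← hy1 γ (Ne.symm hne)]
    exact neg_nonpos.2 (toDeg_nonneg γ)

variable (k)

/-- The one-to-one correspondence, a `k`-isomorphism, between the graded homomorphisms
`⨁ j, Σ^{β_j} R → ⨁ i, Σ^{α_i} R^∨` of degree `0` and the monomial matrices with cogenerator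
degrees `α` and generator degrees `β`. -/
def millerEquiv (α : ι → Deg n) (β : κ → Deg n) :
    gradedHom (freeGrading k β) (cofreeGrading k α) ≃ₗ[k] monomialMatrix k α β where
  toFun φ := ⟨homToMatrix α β φ.1, homToMatrix_mem α β φ.1⟩
  invFun A := ⟨matrixToHom α β A.1, matrixToHom_mem A.2⟩
  left_inv φ := Subtype.ext (matrixToHom_homToMatrix φ.2)
  right_inv A := Subtype.ext (homToMatrix_matrixToHom A.2)
  map_add' φ ψ := by
    refine Subtype.ext (Matrix.ext fun i j => ?_)
    by_cases h : β j ≤ α i <;> simp [homToMatrix, h]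
  map_smul' c φ := by
    refine Subtype.ext (Matrix.ext fun i j => ?_)
    by_cases h : β j ≤ α i <;> simp [homToMatrix, h]

end MonomialMatrices

/-! ## The monomial matrix of the associated presentation -/

section AssocMatrix

variable {k : Type*} [Field k] {n : ℕ}
variable {M : Type*} [AddCommGroup M] [Module k M]
  [Module (Poly k n) M] [IsScalarTower k (Poly k n) M]

/-- The support of a graded module. -/
def grSupport (ℳ : Deg n → Submodule k M) : Set (Deg n) := {g | ℳ g ≠ ⊥}

/-- The index set `⋃ g ∈ supp M, {g} × {1, …, d_g}` with `d_g = dim_k M_g`. -/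
abbrev BasisIndex (ℳ : Deg n → Submodule k M) : Type :=
  Σ g : grSupport ℳ, Fin (Module.finrank k (ℳ g))

/-- The degree `g` of an index `(g, μ)`. -/
def indexDeg (ℳ : Deg n → Submodule k M) (i : BasisIndex ℳ) : Deg n := i.1

/-- The monomial matrix of `M` with respect to chosen bases of its graded pieces: the entry at
`((g, μ), (h, ν))` is the `μ`-th coefficient of `X ^ (g - h) • e_(h, ν) ∈ M_g` if `h ≤ g`, and
`0` otherwise. -/
def assocMatrix (ℳ : Deg n → Submodule k M) [SetLike.GradedSMul (stdGrading k n) ℳ]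
    (e : ∀ g : grSupport ℳ, Module.Basis (Fin (Module.finrank k (ℳ g))) k (ℳ g)) :
    monomialMatrix k (indexDeg ℳ) (indexDeg ℳ) :=
  open Classical in
  ⟨Matrix.of fun i j => if hle : indexDeg ℳ j ≤ indexDeg ℳ i then
      (e i.1).repr ⟨monom k (indexDeg ℳ i - indexDeg ℳ j) • (e j.1 j.2 : M),
        monom_smul_mem (e j.1 j.2).2 hle⟩ i.2
    else 0,
  fun i j h => by simp [h]⟩

/-- The homomorphism `⨁ (h, ν), Σ^h R → F_M` that sends the canonical generator at `(h, ν)` to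
`1 ⊗ e_(h, ν) ∈ Σ^h R ⊗_k M_h`. -/
def freeCoord (ℳ : Deg n → Submodule k M)
    (e : ∀ g : grSupport ℳ, Module.Basis (Fin (Module.finrank k (ℳ g))) k (ℳ g)) :
    (BasisIndex ℳ →₀ Poly k n) →ₗ[Poly k n] AssocFlat ℳ :=
  Finsupp.linearCombination (Poly k n) fun j =>
    DirectSum.lof (Poly k n) (Deg n) (fun g => Poly k n ⊗[k] ℳ g) j.1 (1 ⊗ₜ[k] e j.1 j.2)

/-- The homomorphism `E_M → ⨁ (g, μ), Σ^g R^∨` whose component at `(g, μ)` is the evaluation of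
the factor `Hom_k((M^∨)_{-g}, Σ^g R^∨)` at the dual basis vector `e^*_(g, μ)`, seen as an element
of `(M^∨)_{-g} ≅ Hom_k(M_g, k)`. -/
def cofreeCoord (ℳ : Deg n → Submodule k M) [DirectSum.Decomposition ℳ]
    [SetLike.GradedSMul (stdGrading k n) ℳ]
    (e : ∀ g : grSupport ℳ, Module.Basis (Fin (Module.finrank k (ℳ g))) k (ℳ g)) :
    AssocInj ℳ →ₗ[Poly k n] (BasisIndex ℳ → RDual k n) where
  toFun y := fun i => y.1 (-indexDeg ℳ i) (dualPiece ℳ (indexDeg ℳ i) ((e i.1).coord i.2))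
  map_add' _ _ := rfl
  map_smul' _ _ := rfl

end AssocMatrix

end FlatInj

end

open FlatInj

set_option linter.unusedSectionVars false

noncomputable section

open scoped TensorProduct DirectSum

/-! Everything rests on `(M^∨)_{-g} ≅ Hom_k(M_g, k)`. Since `X^γ` moves the coefficient at `X^{-γ}`
to the one at `X^0`, an `R`-linear map `f : M → E(k)` is recovered from the functional "coefficient
of `f(m)` at `X^0`"; for `f` of degree `-g` this functional lives on `M_g` alone (`dual_ext`), and
`dualPiece` realises every functional on `M_g` (`coeffAt_zero_dualPiece`). A basis of `M_g`
therefore has a dual basis in `(M^∨)_{-g}`.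

On the injective side, a `k`-linear map out of `(M^∨)_h` is its list of values on that dual basis.
The resulting expansion `assocAmbient_apply_eq_sum` gives injectivity of `cofreeCoord` and the
comparison of gradings; `cofreeIncl` gives surjectivity. On the flat side, the chosen basis of `M_g`
becomes an `R`-basis of `R ⊗ M_g`, and `freeCoord` leaves coordinates in it unchanged
(`repr_freeCoord`).

For the matrix, follow a generator: `1 ⊗ e_j` goes to `e_j`, then to evaluation at `e_j`, and its
component at `i` is multiplication by the element of `E(k)` that `e_i^*` assigns to `e_j`. If `i`
has degree `g` and `j` has degree `h ≤ g`, the coefficient of that element at `X^{h-g}` is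
`e_i^*(X^{g-h} e_j)`, the entry of the matrix. -/

namespace FlatInj

/-! ### Modules generated by homogeneous pieces -/

section HomPart

variable {k : Type*} [Field k] {n : ℕ} {M : Type*} [AddCommMonoid M] [Module k M]
  [Module (Poly k n) M] [IsScalarTower k (Poly k n) M]

/-- The module generated by homogeneous pieces is generated by its own homogeneous pieces. -/
theorem mem_homPart_homPartGrading (ℳ : Deg n → Submodule k M) (x : homPart ℳ) :
    x ∈ homPart (homPartGrading ℳ) := by
  -- Pushing the span forward along the injective inclusion into `M` reduces the claim to the
  -- generators of `homPart ℳ`.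
  have h : homPart ℳ ≤ (homPart (homPartGrading ℳ)).map (homPart ℳ).subtype := by
    refine Submodule.span_le.2 fun m hm => ?_
    obtain ⟨a, ha⟩ := Set.mem_iUnion.1 hm
    exact ⟨⟨m, mem_homPart ha⟩, mem_homPart (a := a) ha, rfl⟩
  obtain ⟨y, hy, hyx⟩ := h x.2
  rwa [← show y = x from Subtype.ext hyx]

end HomPart

/-! ### Graded pieces of the Matlis dual as dual vector spaces -/

section DualCoordinates

variable {k : Type*} [Field k] {n : ℕ} {M : Type*} [AddCommGroup M] [Module k M]
  [Module (Poly k n) M] [IsScalarTower k (Poly k n) M] {ℳ : Deg n → Submodule k M}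

theorem coeffAt_zero_eq_zero_of_mem {a : Deg n} {x : InjHull k n} (hx : x ∈ hullGrading k n a)
    (ha : a ≠ 0) : coeffAt 0 x = 0 := by
  by_contra h
  exact ha (by rw [← hx 0 h, toDeg_zero, neg_zero])

/-- This makes a map into `E(k)` as determined as a single functional: all coefficients are read off
at `X^0` after multiplying by monomials. -/
theorem coeffAt_eq_coeffAt_zero (f : M →ₗ[Poly k n] InjHull k n) (m : M) (γ : Fin n →₀ ℕ) :
    coeffAt γ (f m) = coeffAt 0 (f ((MvPolynomial.monomial γ (1 : k) : Poly k n) • m)) := by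
  rw [map_smul, coeffAt_monomial_smul, zero_add, one_mul]

/-- The value `f(m)` has degree `b + h`, while `X^0` sits in degree `0`. All later vanishing of
pairings between mismatched degrees comes from here. -/
theorem coeffAt_zero_dual_eq_zero {h b : Deg n} {f : Dual ℳ} (hf : f ∈ dualGrading ℳ h) {m : M}
    (hm : m ∈ ℳ b) (hb : b + h ≠ 0) : coeffAt 0 (f.1 m) = 0 :=
  coeffAt_zero_eq_zero_of_mem (hf (b + h) m (by rwa [shift, add_sub_cancel_right])) hb

/-- A homogeneous element of degree `-g` of the Matlis dual is determined by the coefficients at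
`X ^ 0` of its values on `M_g`. -/
theorem dual_ext [DirectSum.Decomposition ℳ] [SetLike.GradedSMul (stdGrading k n) ℳ]
    {g : Deg n} {f f' : dualGrading ℳ (-g)}
    (h : ∀ m ∈ ℳ g, coeffAt 0 (f.1.1 m) = coeffAt 0 (f'.1.1 m)) : f = f' := by
  refine Subtype.ext (Subtype.ext (LinearMap.ext fun m => ?_))
  induction m using DirectSum.Decomposition.inductionOn ℳ with
  | zero => rw [map_zero, map_zero]
  | add m m' h h' => rw [map_add, map_add, h, h']
  | @homogeneous b m =>
    refine InjHull.ext fun γ => ?_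
    rw [coeffAt_eq_coeffAt_zero, coeffAt_eq_coeffAt_zero f'.1.1]
    have hm := monomial_smul_mem m.2 γ (1 : k)
    -- Only the `γ` that moves `m` into degree `g` can contribute; for every other `γ` both
    -- coefficients vanish by degree.
    by_cases hb : toDeg γ + b = g
    · exact h _ (hb ▸ hm)
    · have hb' : toDeg γ + b + -g ≠ 0 := fun h0 => hb (add_neg_eq_zero.1 h0)
      rw [coeffAt_zero_dual_eq_zero f.2 hm hb', coeffAt_zero_dual_eq_zero f'.2 hm hb']

/-- Together with `dual_ext`, this makes `dualPiece` inverse to taking coefficients at `X^0`. -/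
theorem coeffAt_zero_dualPiece [DirectSum.Decomposition ℳ]
    [SetLike.GradedSMul (stdGrading k n) ℳ] (g : Deg n) (l : Module.Dual k (ℳ g)) (m : ℳ g) :
    coeffAt 0 ((dualPiece ℳ g l).1.1 m) = l m := by
  change coeffAt 0 (dualElt ℳ g l m) = l m
  rw [coeffAt_dualElt]
  congr 1
  rw [show (MvPolynomial.monomial (0 : Fin n →₀ ℕ) (1 : k) : Poly k n) = 1 from rfl, one_smul,
    DirectSum.decompose_coe, DirectSum.of_eq_same]

/-- The coefficient at `X ^ 0` of the value at `m`, as a functional on `(M^∨)_h`. -/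
def valueCoeff (ℳ : Deg n → Submodule k M) (h : Deg n) (m : M) : dualGrading ℳ h →ₗ[k] k where
  toFun f := coeffAt 0 (f.1.1 m)
  map_add' f f' := map_add (coeffAt (k := k) 0) (f.1.1 m) (f'.1.1 m)
  map_smul' c f := map_smul (coeffAt (k := k) 0) c (f.1.1 m)

theorem valueCoeff_apply (h : Deg n) (m : M) (f : dualGrading ℳ h) :
    valueCoeff ℳ h m f = coeffAt 0 (f.1.1 m) := rfl

theorem valueCoeff_eq_zero {h b : Deg n} {m : M} (hm : m ∈ ℳ b) (hb : b + h ≠ 0)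
    (f : dualGrading ℳ h) : valueCoeff ℳ h m f = 0 :=
  coeffAt_zero_dual_eq_zero f.2 hm hb

/-- Expansion in a dual basis: by `dual_ext` it is enough to pair both sides with an `m` in `M_g`,
and there it is the expansion of `m` in the basis `b`. -/
theorem sum_valueCoeff_smul_dualPiece [DirectSum.Decomposition ℳ]
    [SetLike.GradedSMul (stdGrading k n) ℳ] {g : Deg n} {ι : Type*} [Fintype ι]
    (b : Module.Basis ι k (ℳ g)) (f : dualGrading ℳ (-g)) :
    ∑ μ, valueCoeff ℳ (-g) (b μ) f • dualPiece ℳ g (b.coord μ) = f := by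
  refine dual_ext fun m hm => ?_
  lift m to ℳ g using hm
  change valueCoeff ℳ (-g) m _ = valueCoeff ℳ (-g) m f
  rw [map_sum]
  simp_rw [map_smul, valueCoeff_apply, coeffAt_zero_dualPiece, Module.Basis.coord_apply]
  conv_rhs => rw [← b.sum_repr m]
  simp only [Submodule.coe_sum, Submodule.coe_smul, map_sum, smul_eq_mul]
  refine Finset.sum_congr rfl fun μ _ => ?_
  rw [LinearMap.map_smul_of_tower, map_smul, smul_eq_mul, mul_comm]

end DualCoordinates

/-! ### Coordinates on the associated injective module -/

section Coordinates

variable {k : Type*} [Field k] {n : ℕ} {M : Type*} [AddCommGroup M] [Module k M]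
  [Module (Poly k n) M] [IsScalarTower k (Poly k n) M] {ℳ : Deg n → Submodule k M}

theorem eq_zero_of_notMem_grSupport {g : Deg n} (hg : g ∉ grSupport ℳ) (m : ℳ g) : m = 0 := by
  have h : ℳ g = ⊥ := not_not.1 hg
  exact Subtype.ext ((Submodule.mem_bot k).1 (h ▸ m.2))

theorem finite_basisIndex (hsupp : (grSupport ℳ).Finite) : Finite (BasisIndex ℳ) :=
  have := hsupp.to_subtype
  inferInstance

variable (e : ∀ g : grSupport ℳ, Module.Basis (Fin (Module.finrank k (ℳ g))) k (ℳ g))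

theorem basis_mem (i : BasisIndex ℳ) : (e i.1 i.2 : M) ∈ ℳ (indexDeg ℳ i) := (e i.1 i.2).2

/-- The expansion of an element of `E_M` in the dual bases. -/
theorem assocAmbient_apply_eq_sum [DirectSum.Decomposition ℳ]
    [SetLike.GradedSMul (stdGrading k n) ℳ] [Fintype (BasisIndex ℳ)] (y : AssocInj ℳ)
    (h : Deg n) (f : dualGrading ℳ h) :
    y.1 h f = ∑ i : BasisIndex ℳ, valueCoeff ℳ h (e i.1 i.2) f • cofreeCoord ℳ e y i := by
  classical
  -- Degrees of the dual are written as `-g`, the form in which `dualPiece` lives.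
  obtain ⟨g, rfl⟩ : ∃ g, h = -g := ⟨-h, (neg_neg h).symm⟩
  have hne : ∀ i : BasisIndex ℳ, indexDeg ℳ i ≠ g → valueCoeff ℳ (-g) (e i.1 i.2) f = 0 :=
    fun i hi => valueCoeff_eq_zero (basis_mem e i) (fun h0 => hi (add_neg_eq_zero.1 h0)) f
  by_cases hg : g ∈ grSupport ℳ
  · have hinj : Function.Injective fun μ => (⟨⟨g, hg⟩, μ⟩ : BasisIndex ℳ) :=
      fun μ μ' h => eq_of_heq (Sigma.mk.inj h).2
    -- Only the indices in degree `g` pair nontrivially with `f`, so the sum collapses to the basis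
    -- of the single piece `M_g`.
    rw [← Finset.sum_subset (Finset.subset_univ (Finset.univ.map ⟨_, hinj⟩)), Finset.sum_map]
    · conv_lhs => rw [← sum_valueCoeff_smul_dualPiece (e ⟨g, hg⟩) f]
      simp only [map_sum, map_smul]
      rfl
    · rintro ⟨⟨g', hg'⟩, μ⟩ - hi
      rw [hne, zero_smul]
      rintro rfl
      exact hi (Finset.mem_map.2 ⟨μ, Finset.mem_univ _, rfl⟩)
  -- Off the support `M_g = 0`, hence `(M^∨)_{-g} = 0`.
  · have hf : f = 0 := dual_ext fun m hm => by
      have := congrArg Subtype.val (eq_zero_of_notMem_grSupport hg ⟨m, hm⟩)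
      change m = 0 at this
      rw [this, map_zero (f.1.1), map_zero ((0 : dualGrading ℳ (-g)).1.1)]
    rw [hf, map_zero]
    refine (Finset.sum_eq_zero fun i _ => ?_).symm
    rw [map_zero, zero_smul]

/-- The homomorphism `Σ^g R^∨ → ∏ h, Hom_k((M^∨)_h, Σ^{-h} R^∨)` that sends `z` to the family of
maps `f ↦ f(m)₀ z`, for `m ∈ M_g`. -/
def cofreeIncl (ℳ : Deg n → Submodule k M) (m : M) : RDual k n →ₗ[Poly k n] AssocAmbient ℳ where
  toFun z := fun h => (valueCoeff ℳ h m).smulRight z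
  map_add' z z' := by
    funext h
    ext1 f
    exact smul_add _ z z'
  map_smul' r z := by
    funext h
    ext1 f
    exact smul_comm _ r z

/-- Since `R^∨` is generated by its homogeneous elements, `z` may be taken homogeneous. Then only
the factor `h = -g` is nonzero, and the shift there raises the degree of `z` by `g`. -/
theorem cofreeIncl_mem {g : Deg n} {m : M} (hm : m ∈ ℳ g) (z : RDual k n) :
    cofreeIncl ℳ m z ∈ AssocInj ℳ := by
  have h : homPart (rDualGrading k n) ≤ (AssocInj ℳ).comap (cofreeIncl ℳ m) := by
    refine Submodule.span_le.2 fun z hz => ?_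
    obtain ⟨a, ha⟩ := Set.mem_iUnion.1 hz
    refine mem_homPart (a := a + g) fun h f => ?_
    change valueCoeff ℳ h m f • z ∈ rDualGrading k n (a + g - -h)
    by_cases hb : g + h = 0
    · rw [sub_neg_eq_add, add_assoc, hb, add_zero]
      exact (rDualGrading k n a).smul_mem _ ha
    · rw [valueCoeff_eq_zero hm hb, zero_smul]
      exact zero_mem _
  exact h (mem_homPart_homPartGrading _ z)

variable [DirectSum.Decomposition ℳ] [SetLike.GradedSMul (stdGrading k n) ℳ]

/-- Within one degree this is the duality of a basis and its coordinate functionals; across degrees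
the pairing vanishes. -/
theorem valueCoeff_dualPiece_basis (i j : BasisIndex ℳ) :
    valueCoeff ℳ (-indexDeg ℳ i) (e j.1 j.2) (dualPiece ℳ (indexDeg ℳ i) ((e i.1).coord i.2)) =
      open Classical in if j = i then 1 else 0 := by
  classical
  obtain ⟨g, μ⟩ := i
  obtain ⟨h, ν⟩ := j
  by_cases hgh : h = g
  · subst hgh
    change coeffAt 0 ((dualPiece ℳ h.1 ((e h).coord μ)).1.1 (e h ν)) = _
    rw [coeffAt_zero_dualPiece, Module.Basis.coord_apply, Module.Basis.repr_self,
      Finsupp.single_apply]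
    simp
  · rw [if_neg fun h0 => hgh (congrArg Sigma.fst h0)]
    exact valueCoeff_eq_zero (e h ν).2 (fun h0 => hgh (Subtype.ext (add_neg_eq_zero.1 h0))) _

/-- The dual-basis expansion recovers `y` from its coordinates. Conversely, a preimage of `z` is the
sum of the images of its components under `cofreeIncl`; finiteness of the index set makes this sum
available. -/
theorem cofreeCoord_bijective [Finite (BasisIndex ℳ)] :
    Function.Bijective (cofreeCoord ℳ e) := by
  classical
  have := Fintype.ofFinite (BasisIndex ℳ)
  constructor
  · intro y y' hy
    refine Subtype.ext (funext fun h => LinearMap.ext fun f => ?_)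
    rw [assocAmbient_apply_eq_sum e y, assocAmbient_apply_eq_sum e y', hy]
  · intro z
    refine ⟨∑ j : BasisIndex ℳ, ⟨_, cofreeIncl_mem (basis_mem e j) (z j)⟩, ?_⟩
    rw [map_sum]
    funext i
    rw [Finset.sum_apply, Finset.sum_eq_single i]
    · change valueCoeff ℳ _ _ _ • z i = z i
      rw [valueCoeff_dualPiece_basis, if_pos rfl, one_smul]
    · intro j _ hj
      change valueCoeff ℳ _ _ _ • z j = 0
      rw [valueCoeff_dualPiece_basis, if_neg hj, zero_smul]
    · exact fun h => absurd (Finset.mem_univ i) h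

/-- For the direction from coordinates to `y`, the expansion writes `y h f` through the coordinates
of degree `-h` only, and these carry exactly the shift of the factor at `h`. -/
theorem cofreeCoord_mem_iff [Finite (BasisIndex ℳ)] (a : Deg n) (y : AssocInj ℳ) :
    cofreeCoord ℳ e y ∈ cofreeGrading k (indexDeg ℳ) a ↔ y ∈ assocInjGrading ℳ a := by
  have := Fintype.ofFinite (BasisIndex ℳ)
  rw [mem_cofreeGrading]
  constructor
  · intro hy h f
    change y.1 h f ∈ rDualGrading k n (a - -h)
    rw [assocAmbient_apply_eq_sum e y]
    refine sum_mem fun i _ => ?_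
    by_cases hb : indexDeg ℳ i + h = 0
    · rw [neg_eq_of_add_eq_zero_left hb]
      exact (rDualGrading k n _).smul_mem _ (hy i)
    · rw [valueCoeff_eq_zero (basis_mem e i) hb, zero_smul]
      exact zero_mem _
  · intro hy i
    have h : y.1 (-indexDeg ℳ i) (dualPiece ℳ (indexDeg ℳ i) ((e i.1).coord i.2)) ∈
        rDualGrading k n (a - -(-indexDeg ℳ i)) := hy _ _
    rwa [neg_neg] at h

end Coordinates

/-! ### Coordinates on the associated flat module -/

section FreeCoordinates

variable {k : Type*} [Field k] {n : ℕ}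

/-- A basis splits `R ⊗ V` into copies of `R`, and `S ⊗ V` is then the sum of the corresponding
copies of `S`. With `S` a graded piece of a shift of `R`, this describes the grading of `F_M`
coordinatewise. -/
theorem mem_range_rTensor_iff {R V ι : Type*} [CommRing R] [Algebra k R] [AddCommGroup V]
    [Module k V] [Fintype ι] (b : Module.Basis ι k V) (S : Submodule k R) (w : R ⊗[k] V) :
    w ∈ LinearMap.range (LinearMap.rTensor V S.subtype) ↔
      ∀ μ, (b.baseChange R).repr w μ ∈ S := by
  constructor
  · rintro ⟨t, rfl⟩ μ
    induction t using TensorProduct.induction_on with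
    | zero => simp
    | tmul s v =>
      simp only [LinearMap.rTensor_tmul, Submodule.subtype_apply,
        Module.Basis.baseChange_repr_tmul]
      exact S.smul_mem _ s.2
    | add t t' h h' =>
      rw [map_add, map_add]
      exact S.add_mem h h'
  · intro h
    rw [← (b.baseChange R).sum_repr w]
    refine sum_mem fun μ _ => ⟨⟨_, h μ⟩ ⊗ₜ b μ, ?_⟩
    rw [Module.Basis.baseChange_apply, TensorProduct.smul_tmul', smul_eq_mul, mul_one]
    rfl

variable {M : Type*} [AddCommGroup M] [Module k M]
  [Module (Poly k n) M] [IsScalarTower k (Poly k n) M] {ℳ : Deg n → Submodule k M}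
  (e : ∀ g : grSupport ℳ, Module.Basis (Fin (Module.finrank k (ℳ g))) k (ℳ g))

/-- Canonical generators go to the base-changed basis vectors. Bijectivity of `freeCoord` and its
compatibility with gradings are both read off from this formula. -/
theorem repr_freeCoord (x : BasisIndex ℳ →₀ Poly k n) (g : grSupport ℳ)
    (ν : Fin (Module.finrank k (ℳ g))) :
    ((e g).baseChange (Poly k n)).repr (freeCoord ℳ e x g) ν = x ⟨g, ν⟩ := by
  classical
  induction x using Finsupp.induction_linear with
  | zero => simp
  | add x y hx hy => rw [map_add, DirectSum.add_apply, map_add, Finsupp.add_apply, hx, hy,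
      Finsupp.add_apply]
  | single j r =>
    obtain ⟨h, μ⟩ := j
    rw [freeCoord, Finsupp.linearCombination_single, DirectSum.smul_apply, map_smul,
      Finsupp.smul_apply]
    by_cases hgh : h = g
    · subst hgh
      rw [DirectSum.lof_apply, Module.Basis.baseChange_repr_tmul, Module.Basis.repr_self]
      simp only [Finsupp.single_apply, Sigma.mk.injEq, heq_eq_eq, true_and]
      split_ifs <;> simp
    · have h0 : DirectSum.lof (Poly k n) (Deg n) (fun g => Poly k n ⊗[k] ℳ g) h
          (1 ⊗ₜ[k] e h μ) g = 0 :=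
        DirectSum.of_eq_of_ne (h : Deg n) (g : Deg n) _ fun h0 => hgh (Subtype.ext h0.symm)
      rw [h0, map_zero, Finsupp.zero_apply, smul_zero, Finsupp.single_apply, if_neg]
      exact fun h1 => hgh (congrArg Sigma.fst h1)

theorem tensor_eq_zero_of_notMem_grSupport {g : Deg n} (hg : g ∉ grSupport ℳ)
    (w : Poly k n ⊗[k] ℳ g) : w = 0 := by
  have h : ℳ g = ⊥ := not_not.1 hg
  have : Subsingleton (ℳ g) := by rw [h]; infer_instance
  exact Subsingleton.elim _ _

/-- Summands outside the support are zero, so the chosen bases see all of `F_M`. -/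
theorem assocFlat_ext {w w' : AssocFlat ℳ}
    (h : ∀ (g : grSupport ℳ) (ν : Fin (Module.finrank k (ℳ g))),
      ((e g).baseChange (Poly k n)).repr (w g) ν = ((e g).baseChange (Poly k n)).repr (w' g) ν) :
    w = w' := by
  refine DFinsupp.ext fun g => ?_
  by_cases hg : g ∈ grSupport ℳ
  · exact ((e ⟨g, hg⟩).baseChange (Poly k n)).repr.injective (Finsupp.ext (h ⟨g, hg⟩))
  · rw [tensor_eq_zero_of_notMem_grSupport hg (w g), tensor_eq_zero_of_notMem_grSupport hg (w' g)]

theorem freeCoord_bijective [Finite (BasisIndex ℳ)] : Function.Bijective (freeCoord ℳ e) := by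
  constructor
  · intro x x' hx
    refine Finsupp.ext fun i => ?_
    rw [← repr_freeCoord e x i.1 i.2, hx, repr_freeCoord]
  · intro w
    refine ⟨Finsupp.equivFunOnFinite.symm fun i =>
      ((e i.1).baseChange (Poly k n)).repr (w i.1) i.2, assocFlat_ext e fun g ν => ?_⟩
    rw [repr_freeCoord]
    rfl

theorem freeCoord_mem_iff (a : Deg n) (x : BasisIndex ℳ →₀ Poly k n) :
    freeCoord ℳ e x ∈ assocFlatGrading ℳ a ↔ x ∈ freeGrading k (indexDeg ℳ) a := by
  rw [mem_freeGrading, assocFlatGrading, Submodule.mem_iInf]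
  simp only [Submodule.mem_comap]
  constructor
  · intro h i
    rw [← repr_freeCoord e x i.1 i.2]
    exact (mem_range_rTensor_iff (e i.1) _ _).1 (h i.1) i.2
  · intro h g
    by_cases hg : g ∈ grSupport ℳ
    · refine (mem_range_rTensor_iff (e ⟨g, hg⟩) _ _).2 fun ν => ?_
      change ((e ⟨g, hg⟩).baseChange (Poly k n)).repr (freeCoord ℳ e x g) ν ∈ _
      exact (repr_freeCoord e x ⟨g, hg⟩ ν).symm ▸ h ⟨⟨g, hg⟩, ν⟩
    · change freeCoord ℳ e x g ∈ _
      rw [tensor_eq_zero_of_notMem_grSupport hg (freeCoord ℳ e x g)]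
      exact zero_mem _

end FreeCoordinates

/-! ### The presentation in coordinates and its matrix -/

section Presentation

variable {k : Type*} [Field k] {n : ℕ} {M : Type*} [AddCommGroup M] [Module k M]
  [Module (Poly k n) M] [IsScalarTower k (Poly k n) M] {ℳ : Deg n → Submodule k M}
  [DirectSum.Decomposition ℳ] [SetLike.GradedSMul (stdGrading k n) ℳ]
  (e : ∀ g : grSupport ℳ, Module.Basis (Fin (Module.finrank k (ℳ g))) k (ℳ g))

theorem assocEpi_freeCoord_single (j : BasisIndex ℳ) :
    assocEpi ℳ (freeCoord ℳ e (Finsupp.single j 1)) = e j.1 j.2 := by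
  rw [freeCoord, Finsupp.linearCombination_single, one_smul, assocEpi, DirectSum.toModule_lof]
  simp

theorem cofreeCoord_assocPres_freeCoord_single (i j : BasisIndex ℳ) :
    cofreeCoord ℳ e (assocPres ℳ (freeCoord ℳ e (Finsupp.single j 1))) i =
      mulHom (dualElt ℳ (indexDeg ℳ i) ((e i.1).coord i.2) (e j.1 j.2)) := by
  -- Once `e_j` is written as the image of its generator in `M`, both sides unfold to the same
  -- element.
  rw [← assocEpi_freeCoord_single e j]
  rfl

/-- Degrees add under the action of `R` on `R^∨`, so being of degree `0` need only be tested on the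
canonical generators. -/
theorem gradedHom_of_single {ι κ : Type*} {α : ι → Deg n} {β : κ → Deg n}
    {φ : (κ →₀ Poly k n) →ₗ[Poly k n] (ι → RDual k n)}
    (hφ : ∀ i j, φ (Finsupp.single j 1) i ∈ rDualGrading k n (β j - α i)) :
    φ ∈ gradedHom (freeGrading k β) (cofreeGrading k α) := by
  intro a x hx
  rw [mem_freeGrading] at hx
  rw [mem_cofreeGrading]
  intro i
  rw [← Finsupp.sum_single x, Finsupp.sum, map_sum, Finset.sum_apply]
  refine sum_mem fun j _ => ?_
  rw [← mul_one (x j), ← smul_eq_mul, ← Finsupp.smul_single, map_smul, Pi.smul_apply]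
  have := smul_mem_rDual (hx j) (hφ i j)
  rwa [sub_add_sub_cancel] at this

theorem cofreeCoord_assocPres_freeCoord_mem :
    cofreeCoord ℳ e ∘ₗ assocPres ℳ ∘ₗ freeCoord ℳ e ∈
      gradedHom (freeGrading k (indexDeg ℳ)) (cofreeGrading k (indexDeg ℳ)) := by
  refine gradedHom_of_single fun i j => ?_
  rw [LinearMap.comp_apply, LinearMap.comp_apply, cofreeCoord_assocPres_freeCoord_single]
  refine mulHom_mem (dualElt_mem ℳ _ _ _ _ ?_)
  change (e j.1 j.2 : M) ∈ ℳ (indexDeg ℳ j - indexDeg ℳ i - -indexDeg ℳ i)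
  rw [sub_neg_eq_add, sub_add_cancel]
  exact (e j.1 j.2).2

/-- The coefficient picked out by `homToMatrix` is, by construction of `dualElt`, the functional
`e_i^*` applied to the degree `g` component of `X^{g-h} e_j`; that vector already lies in `M_g`. -/
theorem homToMatrix_assocPres :
    homToMatrix (indexDeg ℳ) (indexDeg ℳ) (cofreeCoord ℳ e ∘ₗ assocPres ℳ ∘ₗ freeCoord ℳ e) =
      (assocMatrix ℳ e).1 := by
  ext i j
  simp only [homToMatrix, assocMatrix, Matrix.of_apply]
  split_ifs with h
  · rw [LinearMap.comp_apply, LinearMap.comp_apply, cofreeCoord_assocPres_freeCoord_single,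
      mulHom_apply, one_smul]
    exact congrArg ((e i.1).coord i.2) (Subtype.ext <|
      DirectSum.decompose_of_mem_same ℳ (monom_smul_mem (e j.1 j.2).2 h))
  · rfl

theorem monom_smul_basis_eq_sum (g : grSupport ℳ) (j : BasisIndex ℳ)
    (h : indexDeg ℳ j ≤ (g : Deg n)) :
    monom k ((g : Deg n) - indexDeg ℳ j) • (e j.1 j.2 : M) =
      ∑ μ, (assocMatrix ℳ e).1 ⟨g, μ⟩ j • (e g μ : M) := by
  have key := congrArg Subtype.val
    ((e g).sum_repr ⟨monom k ((g : Deg n) - indexDeg ℳ j) • (e j.1 j.2 : M),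
      monom_smul_mem (e j.1 j.2).2 h⟩)
  refine key.symm.trans ?_
  rw [Submodule.coe_sum]
  refine Finset.sum_congr rfl fun μ _ => ?_
  refine congrArg (· • (e g μ : M)) (Eq.symm ?_)
  simp only [assocMatrix, Matrix.of_apply]
  exact dif_pos h

end Presentation

end FlatInj

end

theorem proposition4p3 {k : Type*} [Field k] {n : ℕ}
    {M : Type*} [AddCommGroup M] [Module k M] [Module (MvPolynomial (Fin n) k) M]
    [IsScalarTower k (MvPolynomial (Fin n) k) M]
    -- the `ℤⁿ`-grading of `M`
    (ℳ : (Fin n → ℤ) → Submodule k M) [DirectSum.Decomposition ℳ]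
    [SetLike.GradedSMul (stdGrading k n) ℳ]
    -- `M` is finitely generated and finitely supported
    [Module.Finite (MvPolynomial (Fin n) k) M] (hsupp : (grSupport ℳ).Finite)
    -- the chosen bases of the graded pieces
    (e : ∀ g : grSupport ℳ, Module.Basis (Fin (Module.finrank k (ℳ g))) k (ℳ g)) :
    Finite (BasisIndex ℳ) ∧
    -- the matrix consists of the coefficients of the vectors `X ^ (g - h) • e_(h, ν)`
    (∀ (g : grSupport ℳ) (j : BasisIndex ℳ), indexDeg ℳ j ≤ (g : Fin n → ℤ) →
      monom k ((g : Fin n → ℤ) - indexDeg ℳ j) • (e j.1 j.2 : M) =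
        ∑ μ, (assocMatrix ℳ e).1 ⟨g, μ⟩ j • (e g μ : M)) ∧
    -- the bases identify `F_M` with `⨁ (h, ν), Σ^h R`, as graded modules
    (Function.Bijective (freeCoord ℳ e) ∧
      ∀ a x, freeCoord ℳ e x ∈ assocFlatGrading ℳ a ↔ x ∈ freeGrading k (indexDeg ℳ) a) ∧
    -- the dual bases identify `E_M` with `⨁ (g, μ), Σ^g R^∨`, as graded modules
    (Function.Bijective (cofreeCoord ℳ e) ∧
      ∀ a y, cofreeCoord ℳ e y ∈ cofreeGrading k (indexDeg ℳ) a ↔ y ∈ assocInjGrading ℳ a) ∧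
    -- under these identifications, `φ_M` is a graded homomorphism of degree `0` and
    -- corresponds to the matrix
    ∃ hφ : cofreeCoord ℳ e ∘ₗ assocPres ℳ ∘ₗ freeCoord ℳ e ∈
        gradedHom (freeGrading k (indexDeg ℳ)) (cofreeGrading k (indexDeg ℳ)),
      millerEquiv k (indexDeg ℳ) (indexDeg ℳ)
        ⟨cofreeCoord ℳ e ∘ₗ assocPres ℳ ∘ₗ freeCoord ℳ e, hφ⟩ = assocMatrix ℳ e := by
  have := finite_basisIndex hsupp
  exact ⟨this, monom_smul_basis_eq_sum e, ⟨freeCoord_bijective e, freeCoord_mem_iff e⟩,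
    ⟨cofreeCoord_bijective e, cofreeCoord_mem_iff e⟩, cofreeCoord_assocPres_freeCoord_mem e,
    Subtype.ext (homToMatrix_assocPres e)⟩
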